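/- For a permutation $\pi=a_1a_2\cdots a_n$ of $[n]=\{1,\dots,n\}$, an index $i\in\{1,\dots,n-1\}$ is a descent if $a_i>a_{i+1}$; let $\mathrm{odes}(\pi)$ and $\mathrm{edes}(\pi)$ be the numbers of odd and of even descents $i$ of $\pi$. Let $$A_n(p,q)=\sum_{\pi\in\mathfrak S_n}p^{\mathrm{odes}(\pi)}q^{\mathrm{edes}(\pi)}\in\mathbb Z[p,q],$$ and, for $n\ge 1$, let $\tilde A_n(p,q)=A_n(p,q)$ if $n$ is odd and $\tilde A_n(p,q)=(1+q)A_n(p,q)$ if $n$ is even. Theorem 3.1. The following identities hold as identities of rational functions in $p,q$, and also for all elements $p,q$ of any field with $1+pq\neq 0$. For every $n\ge 1$, $$\tilde A_n(p,q)=(1+pq)^{\lfloor n/2\rfloor}A_n\Big(\frac{p+q}{1+pq},0\Big).$$ Equivalently, for every $n\ge 0$, $$A_{2n+1}(p,q)=(1+pq)^nA_{2n+1}\Big(0,\frac{p+q}{1+pq}\Big),\qquad A_{2n+2}(p,q)=(1+p)(1+pq)^nA_{2n+2}\Big(0,\frac{p+q}{1+pq}\Big).$$ Consequently, for every $n\ge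 1$, in $\mathbb Z[p,q]$, $$\tilde A_n(p,q)=\sum_{j=0}^{\lfloor n/2\rfloor}c_{n,j}\,(p+q)^j(1+pq)^{\lfloor n/2\rfloor-j},$$ where $c_{n,j}$ is the number of permutations $\pi\in\mathfrak S_n$ with $\mathrm{odes}(\pi)=j$ and $\mathrm{edes}(\pi)=0$. -/

import Mathlib

open MvPolynomial

/-- Write a permutation `π` of `n` letters as the word `a₁ a₂ … aₙ`, where `aᵢ` is the value of `π`
at the `i`-th element of `Fin n`, that is `aᵢ = π ⟨i - 1, _⟩`. The index `i` (with `1 ≤ i ≤ n - 1`)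
is a descent of `π` if `aᵢ > aᵢ₊₁`. -/
def IsDescent {n : ℕ} (π : Equiv.Perm (Fin n)) (i : ℕ) : Prop :=
  ∃ (_ : 1 ≤ i) (h : i < n), π ⟨i, h⟩ < π ⟨i - 1, lt_of_le_of_lt (Nat.sub_le i 1) h⟩

instance {n : ℕ} (π : Equiv.Perm (Fin n)) : DecidablePred (IsDescent π) := fun i => by
  unfold IsDescent
  infer_instance

/-- The number of descents of `π` in odd positions. -/
def odes {n : ℕ} (π : Equiv.Perm (Fin n)) : ℕ :=
  ((Finset.Icc 1 (n - 1)).filter fun i => IsDescent π i ∧ Odd i).card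

/-- The number of descents of `π` in even positions. -/
def edes {n : ℕ} (π : Equiv.Perm (Fin n)) : ℕ :=
  ((Finset.Icc 1 (n - 1)).filter fun i => IsDescent π i ∧ Even i).card

/-- The refined Eulerian polynomial `A_n(p,q) = ∑_π p ^ odes π * q ^ edes π` as an element of
`ℤ[p,q]`; the variable `p` is `X 0` and the variable `q` is `X 1`. -/
noncomputable def refinedEulerian (n : ℕ) : MvPolynomial (Fin 2) ℤ :=
  ∑ π : Equiv.Perm (Fin n), X 0 ^ odes π * X 1 ^ edes π

/-- The modified polynomial `Ã_n(p,q)`: it is `A_n(p,q)` for `n` odd, `(1 + q) A_n(p,q)` for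
`n ≥ 2` even, and `1` for `n = 0`. -/
noncomputable def modifiedEulerian (n : ℕ) : MvPolynomial (Fin 2) ℤ :=
  if n = 0 then 1
  else if Odd n then refinedEulerian n
  else (1 + X 1) * refinedEulerian n

/-- The number of permutations of `n` letters with exactly `j` descents in odd positions and no
descent in an even position. -/
def oddDescentCount (n j : ℕ) : ℕ :=
  (Finset.univ.filter fun π : Equiv.Perm (Fin n) => odes π = j ∧ edes π = 0).card

/-! Put a = (1-p)(1-q), C = sinh(√a z)/√a and D = (cosh(√a z) - 1)/a, which are power series in a
and z. The exponential generating functions of A_n over odd n and over even n ≥ 2 are C/(1-(p+q)D)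
and (1+p)D/(1-(p+q)D). So, up to the factor 1+p for even n, A_n is a homogeneous polynomial in p+q
and a. For x = (p+q)/(1+pq) one has p+q = (1+pq)x and a = (1+pq)(1-x), while the pairs (0,x) and
(x,0) give x and 1-x. A power of 1+pq therefore factors out (`alternatingSum_homogeneous`), and
(1+p)(1+q) = (1+pq)(1+x) accounts for the factor 1+q.

The series come from sorting permutations by last letter, with a free weight `t i` for each descent
position i. The recurrence `lastLetterSum_succ` is solved in the binomial basis
(`descentSum_succ_eq`). For weights alternating between p and q this becomes a linear system for the
two series (`oddSeries_eq`, `evenSeries_eq`). -/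

/-- Append a last letter `j` to the word of `σ`, raising the letters that are at least `j`. -/
def extendPerm {n : ℕ} (j : Fin (n + 1)) (σ : Equiv.Perm (Fin n)) : Equiv.Perm (Fin (n + 1)) :=
  (finSuccEquiv' (Fin.last n)).trans ((Equiv.optionCongr σ).trans (finSuccEquiv' j).symm)

@[simp]
theorem extendPerm_last {n : ℕ} (j : Fin (n + 1)) (σ : Equiv.Perm (Fin n)) :
    extendPerm j σ (Fin.last n) = j := by
  simp [extendPerm]

@[simp]
theorem extendPerm_castSucc {n : ℕ} (j : Fin (n + 1)) (σ : Equiv.Perm (Fin n)) (i : Fin n) :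
    extendPerm j σ i.castSucc = j.succAbove (σ i) := by
  have h : finSuccEquiv' (Fin.last n) i.castSucc = some i := by
    rw [← Fin.succAbove_last_apply, finSuccEquiv'_succAbove]
  simp [extendPerm, h]

theorem extendPerm_bijective (n : ℕ) :
    Function.Bijective fun x : Fin (n + 1) × Equiv.Perm (Fin n) => extendPerm x.1 x.2 := by
  rw [Fintype.bijective_iff_injective_and_card]
  constructor
  · rintro ⟨j, σ⟩ ⟨j', σ'⟩ h
    have hj : j = j' := by simpa using congrArg (fun π => π (Fin.last n)) h
    subst hj
    have hσ : σ = σ' := by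
      ext1 i
      simpa using congrArg (fun π => π i.castSucc) h
    rw [hσ]
  · simp [Fintype.card_perm, Nat.factorial_succ]

/-! ### Descent sums refined by the last letter, for arbitrary weights -/

section Weights

variable {R : Type*} [CommRing R] (t : ℕ → R)

/-- The product of the weights `t i` over the descents `i` of `π`. -/
def descentWeight {n : ℕ} (π : Equiv.Perm (Fin n)) : R :=
  ∏ i ∈ (Finset.Icc 1 (n - 1)).filter (IsDescent π), t i

/-- The multivariate Eulerian sum `∑ π, ∏ i ∈ Des π, t i`. -/
def descentSum (n : ℕ) : R := ∑ π : Equiv.Perm (Fin n), descentWeight t π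

/-- The part of `descentSum t (n + 1)` coming from the permutations with last letter `j`. -/
def lastLetterSum (n j : ℕ) : R :=
  ∑ π : Equiv.Perm (Fin (n + 1)), if (π (Fin.last n) : ℕ) = j then descentWeight t π else 0

theorem isDescent_extendPerm_of_le {n : ℕ} (j : Fin (n + 1)) (σ : Equiv.Perm (Fin n)) {i : ℕ}
    (hi : i < n) : IsDescent (extendPerm j σ) i ↔ IsDescent σ i := by
  have h (k : ℕ) (hk : k < n) (hk' : k < n + 1) :
      extendPerm j σ ⟨k, hk'⟩ = j.succAbove (σ ⟨k, hk⟩) :=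
    extendPerm_castSucc j σ ⟨k, hk⟩
  constructor
  · rintro ⟨h1, h2, h3⟩
    refine ⟨h1, hi, ?_⟩
    rwa [h i hi, h (i - 1) (by omega), Fin.succAbove_lt_succAbove_iff] at h3
  · rintro ⟨h1, h2, h3⟩
    refine ⟨h1, by omega, ?_⟩
    rwa [h i hi, h (i - 1) (by omega), Fin.succAbove_lt_succAbove_iff]

theorem isDescent_extendPerm_last {n : ℕ} (j : Fin (n + 2)) (σ : Equiv.Perm (Fin (n + 1))) :
    IsDescent (extendPerm j σ) (n + 1) ↔ (j : ℕ) ≤ σ (Fin.last n) := by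
  have h1 : extendPerm j σ ⟨n + 1, by omega⟩ = j := extendPerm_last j σ
  have h2 : extendPerm j σ ⟨n + 1 - 1, by omega⟩ = j.succAbove (σ (Fin.last n)) :=
    extendPerm_castSucc j σ (Fin.last n)
  have h3 : j < j.succAbove (σ (Fin.last n)) ↔ (j : ℕ) ≤ σ (Fin.last n) := by
    rw [Fin.lt_succAbove_iff_le_castSucc, Fin.le_def, Fin.val_castSucc]
  rw [← h3]
  constructor
  · rintro ⟨_, _, h⟩
    rwa [h1, h2] at h
  · intro h
    refine ⟨by omega, by omega, ?_⟩
    rwa [h1, h2]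

theorem descentWeight_extendPerm {n : ℕ} (j : Fin (n + 2)) (σ : Equiv.Perm (Fin (n + 1))) :
    descentWeight t (extendPerm j σ) =
      descentWeight t σ * if (j : ℕ) ≤ σ (Fin.last n) then t (n + 1) else 1 := by
  simp only [descentWeight, Finset.prod_filter, Nat.add_sub_cancel,
    show n + 2 - 1 = n + 1 from rfl]
  rw [Finset.prod_Icc_succ_top (by omega)]
  congr 1
  · refine Finset.prod_congr rfl fun i hi => ?_
    rw [Finset.mem_Icc] at hi
    simp only [isDescent_extendPerm_of_le j σ (show i < n + 1 by omega)]
  · simp only [isDescent_extendPerm_last]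

theorem descentSum_succ (n : ℕ) :
    descentSum t (n + 1) = ∑ j ∈ Finset.range (n + 1), lastLetterSum t n j := by
  simp only [descentSum, lastLetterSum]
  rw [Finset.sum_comm]
  refine Finset.sum_congr rfl fun π _ => ?_
  rw [Finset.sum_ite_eq, if_pos (Finset.mem_range.2 (π (Fin.last n)).isLt)]

/-- Deleting the last letter leaves a permutation σ; position n+1 is a descent exactly when the last
letter of σ is at least j. The smaller last letters contribute weight 1 = t + (1 - t) instead of t.
-/
theorem lastLetterSum_succ {n j : ℕ} (hj : j ≤ n + 1) :
    lastLetterSum t (n + 1) j = t (n + 1) * descentSum t (n + 1) +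
      (1 - t (n + 1)) * ∑ i ∈ Finset.range j, lastLetterSum t n i := by
  have h1 : lastLetterSum t (n + 1) j = ∑ σ : Equiv.Perm (Fin (n + 1)),
      descentWeight t σ * if j ≤ σ (Fin.last n) then t (n + 1) else 1 := by
    rw [lastLetterSum, ← (Equiv.ofBijective _ (extendPerm_bijective (n + 1))).sum_comp,
      Fintype.sum_prod_type, Finset.sum_eq_single (⟨j, by omega⟩ : Fin (n + 2))]
    · simp [descentWeight_extendPerm]
    · intro b _ hb
      have : (b : ℕ) ≠ j := fun h => hb (Fin.ext h)
      simp [this]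
    · simp
  have h2 : ∑ i ∈ Finset.range j, lastLetterSum t n i = ∑ σ : Equiv.Perm (Fin (n + 1)),
      if (σ (Fin.last n) : ℕ) < j then descentWeight t σ else 0 := by
    simp only [lastLetterSum]
    rw [Finset.sum_comm]
    refine Finset.sum_congr rfl fun π _ => ?_
    rw [Finset.sum_ite_eq]
    simp only [Finset.mem_range]
  rw [h1, h2, descentSum, Finset.mul_sum, Finset.mul_sum, ← Finset.sum_add_distrib]
  refine Finset.sum_congr rfl fun σ _ => ?_
  by_cases h : j ≤ σ (Fin.last n)
  · rw [if_pos h, if_neg (by omega)]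
    ring
  · rw [if_neg h, if_pos (by omega)]
    ring

theorem lastLetterSum_zero_zero : lastLetterSum t 0 0 = 1 := by
  simp [lastLetterSum, descentWeight]

/-- The coefficients of `lastLetterSum t n j` in the binomial basis `j.choose k`. -/
def lastLetterCoeff : ℕ → ℕ → R
  | 0, 0 => 1
  | 0, _ + 1 => 0
  | n + 1, 0 => t (n + 1) * descentSum t (n + 1)
  | n + 1, k + 1 => (1 - t (n + 1)) * lastLetterCoeff n k

theorem sum_range_choose_eq (j k : ℕ) : ∑ i ∈ Finset.range j, i.choose k = j.choose (k + 1) := by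
  induction j with
  | zero => simp
  | succ j ih => rw [Finset.sum_range_succ, ih, Nat.choose_succ_succ', add_comm]

theorem sum_range_sum_mul_choose (c : ℕ → R) (m j : ℕ) :
    ∑ i ∈ Finset.range j, ∑ k ∈ Finset.range m, c k * (i.choose k : R) =
      ∑ k ∈ Finset.range m, c k * (j.choose (k + 1) : R) := by
  rw [Finset.sum_comm]
  refine Finset.sum_congr rfl fun k _ => ?_
  rw [← Finset.mul_sum, ← Nat.cast_sum, sum_range_choose_eq]

theorem lastLetterSum_eq (n : ℕ) : ∀ j ≤ n, lastLetterSum t n j =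
    ∑ k ∈ Finset.range (n + 1), lastLetterCoeff t n k * (j.choose k : R) := by
  induction n with
  | zero =>
    intro j hj
    obtain rfl : j = 0 := by omega
    simp [lastLetterSum_zero_zero, lastLetterCoeff]
  | succ n ih =>
    intro j hj
    rw [lastLetterSum_succ t hj, Finset.sum_congr rfl fun i hi =>
      ih i (by rw [Finset.mem_range] at hi; omega), sum_range_sum_mul_choose,
      Finset.sum_range_succ' _ (n + 1), Finset.mul_sum]
    simp only [lastLetterCoeff, Nat.choose_zero_right, Nat.cast_one, mul_one, mul_assoc]
    rw [add_comm]

theorem descentSum_succ_eq (n : ℕ) : descentSum t (n + 1) =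
    ∑ k ∈ Finset.range (n + 1), lastLetterCoeff t n k * ((n + 1).choose (k + 1) : R) := by
  rw [descentSum_succ, Finset.sum_congr rfl fun i hi =>
    lastLetterSum_eq t n i (by rw [Finset.mem_range] at hi; omega), sum_range_sum_mul_choose]

end Weights

/-! ### Alternating weights and their exponential generating functions -/

section Alternating

open scoped PowerSeries

/-- The sum `∑ π, p ^ odes π * q ^ edes π`, with values in a commutative ring. -/
def alternatingSum {R : Type*} [CommRing R] (p q : R) (n : ℕ) : R :=
  descentSum (fun i => if Odd i then p else q) n

/-- Unfolding the recursion gives k consecutive factors `1 - t i`, ending at i = n. They pair up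
into (1-p)(1-q), and for odd k the unpaired factor has the parity of n. The case n - k = 0 is the
base coefficient 1, with no weight attached. -/
theorem lastLetterCoeff_alternating {R : Type*} [CommRing R] (p q : R) (k : ℕ) : ∀ n, k ≤ n →
    lastLetterCoeff (fun i => if Odd i then p else q) n k =
      ((1 - p) * (1 - q)) ^ (k / 2) * (if Even k then 1 else if Odd n then 1 - p else 1 - q) *
        (if n - k = 0 then 1 else (if Odd (n - k) then p else q) * alternatingSum p q (n - k)) := by
  induction k with
  | zero =>
    rintro (_ | n) _
    · simp [lastLetterCoeff]
    · simp [lastLetterCoeff, alternatingSum]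
  | succ k ih =>
    rintro (_ | n) hn
    · omega
    · rw [lastLetterCoeff, ih n (by omega), Nat.add_sub_add_right]
      rcases Nat.even_or_odd k with hk | hk
      · have h2 : (k + 1) / 2 = k / 2 := by grind
        have h3 : ¬ Even (k + 1) := by grind
        rw [h2, if_pos hk, if_neg h3]
        by_cases hn : Odd (n + 1)
        · simp only [if_pos hn]; ring
        · simp only [if_neg hn]; ring
      · have h2 : (k + 1) / 2 = k / 2 + 1 := by grind
        have h3 : Even (k + 1) := by grind
        have h4 : ¬ Even k := by grind
        rw [h2, if_neg h4, if_pos h3]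
        by_cases hn : Odd n
        · have h5 : ¬ Odd (n + 1) := by grind
          simp only [if_pos hn, if_neg h5]; ring
        · have h5 : Odd (n + 1) := by grind
          simp only [if_neg hn, if_pos h5]; ring

variable {K : Type*} [Field K] [CharZero K] (p q : K)

theorem alternatingSum_div_factorial {n : ℕ} (hn : n ≠ 0) :
    alternatingSum p q n / (n.factorial : K) = ∑ x ∈ Finset.HasAntidiagonal.antidiagonal n,
      if x.1 = 0 then 0 else
        ((1 - p) * (1 - q)) ^ ((x.1 - 1) / 2) / (x.1.factorial : K) *
          (if Odd x.1 then 1 else if Even n then 1 - p else 1 - q) *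
          (if x.2 = 0 then 1 else
            (if Odd x.2 then p else q) * (alternatingSum p q x.2 / (x.2.factorial : K))) := by
  obtain ⟨n, rfl⟩ := Nat.exists_eq_succ_of_ne_zero hn
  rw [Finset.Nat.sum_antidiagonal_succ, if_pos rfl, zero_add,
    Finset.Nat.sum_antidiagonal_eq_sum_range_succ_mk,
    alternatingSum, descentSum_succ_eq, Finset.sum_div]
  refine Finset.sum_congr rfl fun k hk => ?_
  have hk' : k ≤ n := by rw [Finset.mem_range] at hk; omega
  have e1 : Odd (k + 1) ↔ Even k := by grind
  have e2 : Even (n + 1) ↔ Odd n := by grind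
  have f0 : ((n + 1).factorial : K) ≠ 0 := Nat.cast_ne_zero.2 (Nat.factorial_ne_zero _)
  have f1 : ((k + 1).factorial : K) ≠ 0 := Nat.cast_ne_zero.2 (Nat.factorial_ne_zero _)
  have f2 : ((n - k).factorial : K) ≠ 0 := Nat.cast_ne_zero.2 (Nat.factorial_ne_zero _)
  simp only [Nat.succ_eq_add_one, Nat.add_sub_cancel, e1, e2, if_neg (Nat.succ_ne_zero k)]
  rw [lastLetterCoeff_alternating p q k n hk', Nat.cast_choose K (show k + 1 ≤ n + 1 by omega),
    Nat.add_sub_add_right]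
  by_cases h : n - k = 0
  · simp only [h, if_true, Nat.factorial_zero, Nat.cast_one]
    field_simp
  · simp only [if_neg h]
    field_simp

/-- The power series `∑ a ^ i * z ^ (2 * i + 1) / (2 * i + 1)!`. -/
def oddKernel (a : K) : K⟦X⟧ :=
  PowerSeries.mk fun k => if Odd k then a ^ ((k - 1) / 2) / (k.factorial : K) else 0

/-- The power series `∑ a ^ i * z ^ (2 * i + 2) / (2 * i + 2)!`. -/
def evenKernel (a : K) : K⟦X⟧ :=
  PowerSeries.mk fun k =>
    if k ≠ 0 ∧ Even k then a ^ ((k - 1) / 2) / (k.factorial : K) else 0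

/-- The exponential generating function of `alternatingSum p q n` over odd `n`. -/
def oddSeries : K⟦X⟧ :=
  PowerSeries.mk fun n => if Odd n then alternatingSum p q n / (n.factorial : K) else 0

/-- The exponential generating function of `alternatingSum p q n` over even `n ≥ 2`. -/
def evenSeries : K⟦X⟧ :=
  PowerSeries.mk fun n =>
    if n ≠ 0 ∧ Even n then alternatingSum p q n / (n.factorial : K) else 0

theorem derivative_oddKernel (a : K) :
    d⁄dX K (oddKernel a) = 1 + PowerSeries.C a * evenKernel a := by
  ext n
  have f0 : (n.factorial : K) ≠ 0 := Nat.cast_ne_zero.2 (Nat.factorial_ne_zero _)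
  have f1 : (n : K) + 1 ≠ 0 := by exact_mod_cast Nat.succ_ne_zero n
  rw [PowerSeries.coeff_derivative, map_add, PowerSeries.coeff_C_mul, PowerSeries.coeff_one]
  simp only [oddKernel, evenKernel, PowerSeries.coeff_mk, Nat.factorial_succ, Nat.add_sub_cancel]
  push_cast
  rcases Nat.even_or_odd n with h | h
  · rw [if_pos (show Odd (n + 1) by grind)]
    rcases eq_or_ne n 0 with rfl | h0
    · simp
    · have h1 : n / 2 = (n - 1) / 2 + 1 := by grind
      rw [if_neg h0, if_pos ⟨h0, h⟩, h1]
      field_simp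
      ring
  · rw [if_neg (show ¬ Odd (n + 1) by grind), if_neg (show ¬ n = 0 by grind),
      if_neg (show ¬ (n ≠ 0 ∧ Even n) by grind)]
    simp

theorem derivative_evenKernel (a : K) : d⁄dX K (evenKernel a) = oddKernel a := by
  ext n
  have f0 : (n.factorial : K) ≠ 0 := Nat.cast_ne_zero.2 (Nat.factorial_ne_zero _)
  have f1 : (n : K) + 1 ≠ 0 := by exact_mod_cast Nat.succ_ne_zero n
  rw [PowerSeries.coeff_derivative]
  simp only [oddKernel, evenKernel, PowerSeries.coeff_mk, Nat.factorial_succ, Nat.add_sub_cancel]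
  push_cast
  rcases Nat.even_or_odd n with h | h
  · rw [if_neg (show ¬ (n + 1 ≠ 0 ∧ Even (n + 1)) by grind), if_neg (show ¬ Odd n by grind)]
    simp
  · have h1 : n / 2 = (n - 1) / 2 := by grind
    rw [if_pos (show n + 1 ≠ 0 ∧ Even (n + 1) by grind), if_pos h, h1]
    field_simp

theorem constantCoeff_oddKernel {K : Type*} [Field K] (a : K) :
    PowerSeries.constantCoeff (oddKernel a) = 0 := by
  rw [← PowerSeries.coeff_zero_eq_constantCoeff_apply]
  simp [oddKernel]

theorem constantCoeff_evenKernel {K : Type*} [Field K] (a : K) :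
    PowerSeries.constantCoeff (evenKernel a) = 0 := by
  rw [← PowerSeries.coeff_zero_eq_constantCoeff_apply]
  simp [evenKernel]

/-- This is cosh² - sinh² = 1 in disguise: both sides have derivative 2C(1 + aD) and constant term
0. -/
theorem oddKernel_sq (a : K) : oddKernel a ^ 2 =
    2 * evenKernel a + PowerSeries.C a * evenKernel a ^ 2 := by
  apply PowerSeries.derivative.ext
  · have h2 : d⁄dX K (2 : K⟦X⟧) = 0 := by
      rw [show (2 : K⟦X⟧) = PowerSeries.C (2 : K) from (map_ofNat PowerSeries.C 2).symm,
        PowerSeries.derivative_C]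
    simp only [map_add, Derivation.leibniz, pow_two, derivative_oddKernel, derivative_evenKernel,
      PowerSeries.derivative_C, h2, smul_eq_mul]
    ring
  · simp [constantCoeff_oddKernel, constantCoeff_evenKernel]

theorem oddSeries_eq : oddSeries p q =
    oddKernel ((1 - p) * (1 - q)) * (1 + PowerSeries.C q * evenSeries p q) +
      PowerSeries.C (p * (1 - q)) * (evenKernel ((1 - p) * (1 - q)) * oddSeries p q) := by
  ext n
  rw [map_add, PowerSeries.coeff_C_mul, PowerSeries.coeff_mul, PowerSeries.coeff_mul,
    Finset.mul_sum, ← Finset.sum_add_distrib]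
  simp only [map_add, PowerSeries.coeff_C_mul, PowerSeries.coeff_one]
  simp only [oddSeries, evenSeries, oddKernel, evenKernel, PowerSeries.coeff_mk]
  split_ifs with hn
  · rw [alternatingSum_div_factorial p q (show n ≠ 0 by grind)]
    refine Finset.sum_congr rfl fun ⟨k, m⟩ hx => ?_
    rw [Finset.HasAntidiagonal.mem_antidiagonal] at hx
    simp only at hx ⊢
    subst hx
    rcases Nat.even_or_odd k with hk | hk
    · have hm : Odd m := by grind
      have e1 : ¬ Odd k := by grind
      have e2 : ¬ Even (k + m) := by grind
      have e3 : m ≠ 0 := by grind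
      by_cases hk0 : k = 0
      · simp [hk0]
      · simp only [hk, hm, e1, e2, e3, hk0, if_true, if_false, ne_eq, not_false_eq_true, and_self]
        ring
    · have hm : Even m := by grind
      have e1 : ¬ Even k := by grind
      have e3 : ¬ Odd m := by grind
      have hk0 : k ≠ 0 := by grind
      by_cases hm0 : m = 0
      · simp [hk, hm0, hk0]
      · simp only [hk, hm, e1, e3, hk0, hm0, if_true, if_false, ne_eq, not_false_eq_true, and_self,
          and_false]
        ring
  · symm
    refine Finset.sum_eq_zero fun ⟨k, m⟩ hx => ?_
    rw [Finset.HasAntidiagonal.mem_antidiagonal] at hx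
    simp only at hx ⊢
    rcases Nat.even_or_odd k with hk | hk
    · rw [if_neg (show ¬ Odd k by grind), if_neg (show ¬ Odd m by grind)]
      simp
    · rw [if_neg (show ¬ m = 0 by grind), if_neg (show ¬ (m ≠ 0 ∧ Even m) by grind),
        if_neg (show ¬ (k ≠ 0 ∧ Even k) by grind)]
      simp

theorem evenSeries_eq : evenSeries p q =
    PowerSeries.C p * (oddKernel ((1 - p) * (1 - q)) * oddSeries p q) +
      PowerSeries.C (1 - p) *
        (evenKernel ((1 - p) * (1 - q)) * (1 + PowerSeries.C q * evenSeries p q)) := by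
  ext n
  rw [map_add, PowerSeries.coeff_C_mul, PowerSeries.coeff_C_mul, PowerSeries.coeff_mul,
    PowerSeries.coeff_mul, Finset.mul_sum, Finset.mul_sum, ← Finset.sum_add_distrib]
  simp only [map_add, PowerSeries.coeff_C_mul, PowerSeries.coeff_one]
  simp only [oddSeries, evenSeries, oddKernel, evenKernel, PowerSeries.coeff_mk]
  split_ifs with hn
  · rw [alternatingSum_div_factorial p q hn.1]
    refine Finset.sum_congr rfl fun ⟨k, m⟩ hx => ?_
    rw [Finset.HasAntidiagonal.mem_antidiagonal] at hx
    simp only at hx ⊢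
    subst hx
    rcases Nat.even_or_odd k with hk | hk
    · have hm : Even m := by grind
      have e1 : ¬ Odd k := by grind
      have e2 : Even (k + m) := by grind
      have e3 : ¬ Odd m := by grind
      by_cases hk0 : k = 0
      · simp [hk0]
      by_cases hm0 : m = 0
      · simp [hk, hm0, hk0, e1]
        ring
      · simp only [hk, hm, e1, e2, e3, hk0, hm0, if_true, if_false, ne_eq, not_false_eq_true,
          and_self]
        ring
    · have hm : Odd m := by grind
      have e1 : ¬ Even k := by grind
      have e3 : ¬ Even m := by grind
      have hk0 : k ≠ 0 := by grind
      have hm0 : m ≠ 0 := by grind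
      simp only [hk, hm, e1, e3, hk0, hm0, if_true, if_false, ne_eq, not_false_eq_true,
        and_false]
      ring
  · symm
    refine Finset.sum_eq_zero fun ⟨k, m⟩ hx => ?_
    rw [Finset.HasAntidiagonal.mem_antidiagonal] at hx
    simp only at hx ⊢
    rcases Nat.even_or_odd k with hk | hk
    · by_cases hk0 : k = 0
      · simp [hk0]
      · rw [if_neg (show ¬ Odd k by grind), if_neg (show ¬ m = 0 by grind),
          if_neg (show ¬ (m ≠ 0 ∧ Even m) by grind)]
        simp
    · rw [if_neg (show ¬ Odd m by grind), if_neg (show ¬ (k ≠ 0 ∧ Even k) by grind)]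
      simp

theorem oddSeries_add_evenSeries_eq : oddSeries p q + evenSeries p q =
    oddKernel ((1 - p) * (1 - q)) + PowerSeries.C (1 + p) * evenKernel ((1 - p) * (1 - q)) +
      PowerSeries.C (p + q) *
        (evenKernel ((1 - p) * (1 - q)) * (oddSeries p q + evenSeries p q)) := by
  have hO := oddSeries_eq p q
  have hE := evenSeries_eq p q
  have hC := oddKernel_sq ((1 - p) * (1 - q))
  have h0 := constantCoeff_evenKernel ((1 - p) * (1 - q))
  generalize oddSeries p q = O at *
  generalize evenSeries p q = E at *
  generalize oddKernel ((1 - p) * (1 - q)) = C at *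
  generalize evenKernel ((1 - p) * (1 - q)) = D at *
  simp only [map_add, map_sub, map_mul, map_one] at *
  -- This coefficient of O in `hO` has constant term 1, so it can be cancelled later.
  have hu : 1 - PowerSeries.C p * (1 - PowerSeries.C q) * D ≠ 0 := by
    intro h
    simpa [h0] using congrArg PowerSeries.constantCoeff h
  generalize PowerSeries.C p = P at *
  generalize PowerSeries.C q = Q at *
  -- Eliminate O by multiplying `hE` by that coefficient; once C² is replaced by `hC`, the D² terms
  -- cancel.
  have hE' : E * (1 - (P + Q) * D) = (1 + P) * D := by
    linear_combination (1 - P * (1 - Q) * D) * hE + P * C * hO + P * (1 + Q * E) * hC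
  have hO' : O * (1 - (P + Q) * D) = C := by
    apply mul_left_cancel₀ hu
    linear_combination (1 - (P + Q) * D) * hO + C * Q * hE'
  linear_combination hE' + hO'

theorem alternatingSum_recurrence_charZero {n : ℕ} (hn : n ≠ 0) :
    alternatingSum p q n =
      (if Even n then 1 + p else 1) * ((1 - p) * (1 - q)) ^ ((n - 1) / 2) +
        (p + q) * ∑ x ∈ Finset.HasAntidiagonal.antidiagonal n,
          if (x.1 ≠ 0 ∧ Even x.1) ∧ x.2 ≠ 0 then
            (n.choose x.1 : K) * ((1 - p) * (1 - q)) ^ ((x.1 - 1) / 2) * alternatingSum p q x.2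
          else 0 := by
  have h := congrArg (PowerSeries.coeff n) (oddSeries_add_evenSeries_eq p q)
  have hs : oddSeries p q + evenSeries p q = PowerSeries.mk fun n =>
      if n ≠ 0 then alternatingSum p q n / (n.factorial : K) else 0 := by
    ext m
    simp only [map_add, oddSeries, evenSeries, PowerSeries.coeff_mk]
    rcases Nat.even_or_odd m with hm | hm
    · rw [if_neg (show ¬ Odd m by grind)]
      simp [hm]
    · rw [if_pos hm, if_neg (show ¬ (m ≠ 0 ∧ Even m) by grind), if_pos (show m ≠ 0 by grind),
        add_zero]
  rw [hs, map_add, map_add, PowerSeries.coeff_C_mul, PowerSeries.coeff_C_mul,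
    PowerSeries.coeff_mul] at h
  simp only [oddKernel, evenKernel, PowerSeries.coeff_mk, if_pos hn] at h
  have f0 : (n.factorial : K) ≠ 0 := Nat.cast_ne_zero.2 (Nat.factorial_ne_zero _)
  rw [div_eq_iff f0, add_mul, mul_assoc (p + q), Finset.sum_mul] at h
  rw [h]
  congr 1
  · rcases Nat.even_or_odd n with hm | hm
    · rw [if_neg (show ¬ Odd n by grind), if_pos ⟨hn, hm⟩, if_pos hm]
      field_simp
      ring
    · rw [if_pos hm, if_neg (show ¬ (n ≠ 0 ∧ Even n) by grind), if_neg (show ¬ Even n by grind)]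
      field_simp
      ring
  · congr 1
    refine Finset.sum_congr rfl fun ⟨k, m⟩ hx => ?_
    rw [Finset.HasAntidiagonal.mem_antidiagonal] at hx
    simp only at hx ⊢
    subst hx
    have f1 : (k.factorial : K) ≠ 0 := Nat.cast_ne_zero.2 (Nat.factorial_ne_zero _)
    have f2 : (m.factorial : K) ≠ 0 := Nat.cast_ne_zero.2 (Nat.factorial_ne_zero _)
    by_cases hk : k ≠ 0 ∧ Even k
    · by_cases hm : m ≠ 0
      · rw [if_pos hk, if_pos hm, if_pos ⟨hk, hm⟩, Nat.cast_choose K (Nat.le_add_right k m),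
          Nat.add_sub_cancel_left]
        field_simp
      · simp [hm]
    · simp [hk]

end Alternating

/-! ### Transfer to arbitrary commutative rings -/

theorem alternatingSum_eq {R : Type*} [CommRing R] (p q : R) (n : ℕ) :
    alternatingSum p q n = ∑ π : Equiv.Perm (Fin n), p ^ odes π * q ^ edes π := by
  refine Finset.sum_congr rfl fun π _ => ?_
  simp only [descentWeight, odes, edes]
  rw [Finset.prod_ite, Finset.prod_const, Finset.prod_const, Finset.filter_filter,
    Finset.filter_filter]
  simp only [Nat.not_odd_iff_even]

theorem map_alternatingSum {R S : Type*} [CommRing R] [CommRing S] (f : R →+* S) (p q : R)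
    (n : ℕ) : f (alternatingSum p q n) = alternatingSum (f p) (f q) n := by
  simp [alternatingSum_eq]

theorem refinedEulerian_eq (n : ℕ) : refinedEulerian n = alternatingSum (X 0) (X 1) n :=
  (alternatingSum_eq _ _ n).symm

theorem aeval_refinedEulerian {R : Type*} [CommRing R] (p q : R) (n : ℕ) :
    aeval ![p, q] (refinedEulerian n) = alternatingSum p q n := by
  simp [refinedEulerian, alternatingSum_eq]

theorem alternatingSum_recurrence {R : Type*} [CommRing R] (p q : R) {n : ℕ} (hn : n ≠ 0) :
    alternatingSum p q n =
      (if Even n then 1 + p else 1) * ((1 - p) * (1 - q)) ^ ((n - 1) / 2) +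
        (p + q) * ∑ x ∈ Finset.HasAntidiagonal.antidiagonal n,
          if (x.1 ≠ 0 ∧ Even x.1) ∧ x.2 ≠ 0 then
            (n.choose x.1 : R) * ((1 - p) * (1 - q)) ^ ((x.1 - 1) / 2) * alternatingSum p q x.2
          else 0 := by
  have hpoly : alternatingSum (X 0 : MvPolynomial (Fin 2) ℤ) (X 1) n =
      (if Even n then 1 + X 0 else 1) * ((1 - X 0) * (1 - X 1)) ^ ((n - 1) / 2) +
        (X 0 + X 1) * ∑ x ∈ Finset.HasAntidiagonal.antidiagonal n,
          if (x.1 ≠ 0 ∧ Even x.1) ∧ x.2 ≠ 0 then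
            (n.choose x.1 : MvPolynomial (Fin 2) ℤ) * ((1 - X 0) * (1 - X 1)) ^ ((x.1 - 1) / 2) *
              alternatingSum (X 0) (X 1) x.2
          else 0 := by
    -- The series argument divides by factorials, so it is applied to the generic p, q in a field of
    -- characteristic zero; the resulting identity over ℤ[p,q] then specializes to every ring.
    let L := FractionRing (MvPolynomial (Fin 2) ℤ)
    have : CharZero L := charZero_of_injective_algebraMap
      (IsFractionRing.injective (MvPolynomial (Fin 2) ℤ) L)
    apply IsFractionRing.injective (MvPolynomial (Fin 2) ℤ) L
    have h := alternatingSum_recurrence_charZero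
      (algebraMap (MvPolynomial (Fin 2) ℤ) L (X 0)) (algebraMap (MvPolynomial (Fin 2) ℤ) L (X 1)) hn
    simpa [apply_ite (algebraMap (MvPolynomial (Fin 2) ℤ) L), map_alternatingSum] using h
  have h := congrArg (aeval ![p, q] : MvPolynomial (Fin 2) ℤ →ₐ[ℤ] R).toRingHom hpoly
  simpa [apply_ite (aeval ![p, q] : MvPolynomial (Fin 2) ℤ →ₐ[ℤ] R), ← refinedEulerian_eq,
    aeval_refinedEulerian] using h

/-! ### Factoring out 1 + pq -/

theorem alternatingSum_homogeneous {R : Type*} [CommRing R] (p q x : R)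
    (hx : p + q = (1 + p * q) * x) (n : ℕ) (hn : n ≠ 0) :
    alternatingSum p q n =
      (if Even n then 1 + p else 1) * (1 + p * q) ^ ((n - 1) / 2) * alternatingSum 0 x n := by
  induction n using Nat.strong_induction_on with
  | _ n ih =>
    have h1 : (1 - p) * (1 - q) = (1 + p * q) * (1 - x) := by linear_combination -hx
    rw [alternatingSum_recurrence p q hn, alternatingSum_recurrence 0 x hn, h1, hx]
    simp only [add_zero, sub_zero, one_mul, zero_add, ite_self, mul_add, mul_pow]
    congr 1
    · ring
    · rw [← mul_assoc, Finset.mul_sum, Finset.mul_sum]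
      refine Finset.sum_congr rfl fun ⟨k, m⟩ hkm => ?_
      rw [Finset.HasAntidiagonal.mem_antidiagonal] at hkm
      simp only at hkm ⊢
      by_cases h2 : (k ≠ 0 ∧ Even k) ∧ m ≠ 0
      · rw [if_pos h2, if_pos h2]
        split_ifs with h3
        · rw [ih m (by omega) h2.2, if_pos (show Even m by grind),
            -- Degree count in 1 + pq: one from p + q, (k-1)/2 from the power of (1-p)(1-q), and
            -- (m-1)/2 by induction; k is even and positive.
            show (n - 1) / 2 = 1 + (k - 1) / 2 + (m - 1) / 2 by grind]
          ring
        · rw [ih m (by omega) h2.2, if_neg (show ¬ Even m by grind),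
            show (n - 1) / 2 = 1 + (k - 1) / 2 + (m - 1) / 2 by grind]
          ring
      · simp [h2]

theorem alternatingSum_odd {R : Type*} [CommRing R] (p q x : R)
    (hx : p + q = (1 + p * q) * x) (n : ℕ) :
    alternatingSum p q (2 * n + 1) = (1 + p * q) ^ n * alternatingSum 0 x (2 * n + 1) := by
  rw [alternatingSum_homogeneous p q x hx _ (by omega), if_neg (by grind), one_mul,
    show (2 * n + 1 - 1) / 2 = n by omega]

theorem alternatingSum_even {R : Type*} [CommRing R] (p q x : R)
    (hx : p + q = (1 + p * q) * x) (n : ℕ) :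
    alternatingSum p q (2 * n + 2) =
      (1 + p) * (1 + p * q) ^ n * alternatingSum 0 x (2 * n + 2) := by
  rw [alternatingSum_homogeneous p q x hx _ (by omega), if_pos (by grind),
    show (2 * n + 2 - 1) / 2 = n by omega]

theorem aeval_modifiedEulerian {R : Type*} [CommRing R] (p q x : R)
    (hx : p + q = (1 + p * q) * x) (n : ℕ) (hn : 1 ≤ n) :
    aeval ![p, q] (modifiedEulerian n) = (1 + p * q) ^ (n / 2) * alternatingSum x 0 n := by
  have hx' : x + 0 = (1 + x * 0) * x := by ring
  rw [modifiedEulerian, if_neg (by omega)]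
  rcases Nat.even_or_odd' n with ⟨m, rfl | rfl⟩
  · obtain ⟨m, rfl⟩ : ∃ k, m = k + 1 := ⟨m - 1, by omega⟩
    rw [if_neg (by grind), map_mul, aeval_refinedEulerian, show 2 * (m + 1) = 2 * m + 2 by ring,
      alternatingSum_even p q x hx, alternatingSum_even x 0 x hx',
      show (2 * m + 2) / 2 = m + 1 by omega]
    simp only [map_add, map_one, aeval_X, Matrix.cons_val_one, Matrix.cons_val_fin_one, mul_zero,
      add_zero, one_pow, mul_one]
    -- What remains is (1+q)(1+p) = (1+pq)(1+x).
    linear_combination (1 + p * q) ^ m * alternatingSum 0 x (2 * m + 2) * hx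
  · rw [if_pos (by grind), aeval_refinedEulerian, alternatingSum_odd p q x hx,
      alternatingSum_odd x 0 x hx', show (2 * m + 1) / 2 = m by omega]
    simp

/-! ### Expansion in powers of p + q and 1 + pq -/

theorem odes_le {n : ℕ} (π : Equiv.Perm (Fin n)) : odes π ≤ n / 2 := by
  have h : (Finset.Icc 1 (n - 1)).filter (fun i => IsDescent π i ∧ Odd i) ⊆
      (Finset.range (n / 2)).image fun j => 2 * j + 1 := by
    intro i hi
    simp only [Finset.mem_filter, Finset.mem_Icc] at hi
    obtain ⟨⟨_, hi2⟩, _, j, rfl⟩ := hi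
    exact Finset.mem_image.2 ⟨j, Finset.mem_range.2 (by omega), rfl⟩
  exact (Finset.card_le_card h).trans (Finset.card_image_le.trans (by simp))

theorem alternatingSum_zero_right {R : Type*} [CommRing R] (x : R) (n : ℕ) :
    alternatingSum x 0 n =
      ∑ j ∈ Finset.range (n / 2 + 1), (oddDescentCount n j : R) * x ^ j := by
  simp only [alternatingSum_eq, oddDescentCount, Finset.card_filter, Nat.cast_sum, Finset.sum_mul]
  rw [Finset.sum_comm]
  refine Finset.sum_congr rfl fun π _ => ?_
  rw [Finset.sum_eq_single_of_mem (odes π)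
    (Finset.mem_range.2 (Nat.lt_succ_of_le (odes_le π)))]
  · by_cases h : edes π = 0 <;> simp [h]
  · intro j _ hj
    simp [hj.symm]

theorem aeval_map_X {R : Type*} [CommRing R] (f : MvPolynomial (Fin 2) ℤ →+* R)
    (P : MvPolynomial (Fin 2) ℤ) : aeval ![f (X 0), f (X 1)] P = f P := by
  have h : aeval ![f (X 0), f (X 1)] = f.toIntAlgHom := by
    apply MvPolynomial.algHom_ext
    intro i
    fin_cases i <;> simp <;> rfl
  exact DFunLike.congr_fun h P

theorem map_modifiedEulerian {L : Type*} [Field L] (f : MvPolynomial (Fin 2) ℤ →+* L)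
    (hf : Function.Injective f) (n : ℕ) (hn : 1 ≤ n) :
    f (modifiedEulerian n) = f (∑ j ∈ Finset.range (n / 2 + 1),
      (oddDescentCount n j : MvPolynomial (Fin 2) ℤ) *
        (X 0 + X 1) ^ j * (1 + X 0 * X 1) ^ (n / 2 - j)) := by
  -- Evaluating 1 + pq at p = q = 0 gives 1, so it is a nonzero polynomial and x is defined in `L`.
  have hr : 1 + f (X 0) * f (X 1) ≠ 0 := by
    rw [← map_mul, ← map_one f, ← map_add, Ne, map_eq_zero_iff _ hf]
    intro h
    simpa using congrArg (aeval ![(0 : ℤ), 0]) h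
  rw [← aeval_map_X, aeval_modifiedEulerian _ _ _ (mul_div_cancel₀ _ hr).symm n hn,
    alternatingSum_zero_right, map_sum, Finset.mul_sum]
  refine Finset.sum_congr rfl fun j hj => ?_
  have hj' : j ≤ n / 2 := by rw [Finset.mem_range] at hj; omega
  simp only [map_mul, map_pow, map_add, map_one, map_natCast]
  obtain ⟨k, hk⟩ := Nat.exists_eq_add_of_le hj'
  rw [hk, Nat.add_sub_cancel_left, pow_add, div_pow]
  field_simp

theorem modifiedEulerian_eq_sum (n : ℕ) (hn : 1 ≤ n) :
    modifiedEulerian n = ∑ j ∈ Finset.range (n / 2 + 1),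
      (oddDescentCount n j : MvPolynomial (Fin 2) ℤ) *
        (X 0 + X 1) ^ j * (1 + X 0 * X 1) ^ (n / 2 - j) :=
  have hinj := IsFractionRing.injective (MvPolynomial (Fin 2) ℤ)
    (FractionRing (MvPolynomial (Fin 2) ℤ))
  hinj (map_modifiedEulerian _ hinj n hn)

theorem theorem3p1 :
    (∀ (K : Type*) [Field K] (p q : K), 1 + p * q ≠ 0 →
      (∀ n : ℕ, 1 ≤ n →
        aeval ![p, q] (modifiedEulerian n) =
          (1 + p * q) ^ (n / 2) * aeval ![(p + q) / (1 + p * q), 0] (refinedEulerian n)) ∧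
      (∀ n : ℕ,
        aeval ![p, q] (refinedEulerian (2 * n + 1)) =
          (1 + p * q) ^ n *
            aeval ![0, (p + q) / (1 + p * q)] (refinedEulerian (2 * n + 1))) ∧
      (∀ n : ℕ,
        aeval ![p, q] (refinedEulerian (2 * n + 2)) =
          (1 + p) * (1 + p * q) ^ n *
            aeval ![0, (p + q) / (1 + p * q)] (refinedEulerian (2 * n + 2)))) ∧
    (∀ n : ℕ, 1 ≤ n →
      modifiedEulerian n =
        ∑ j ∈ Finset.range (n / 2 + 1),
          (oddDescentCount n j : MvPolynomial (Fin 2) ℤ) *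
            (X 0 + X 1) ^ j * (1 + X 0 * X 1) ^ (n / 2 - j)) := by
  refine ⟨fun K _ p q hr => ?_, modifiedEulerian_eq_sum⟩
  have hx : p + q = (1 + p * q) * ((p + q) / (1 + p * q)) := (mul_div_cancel₀ _ hr).symm
  simp only [aeval_refinedEulerian]
  exact ⟨aeval_modifiedEulerian p q _ hx, alternatingSum_odd p q _ hx,
    alternatingSum_even p q _ hx⟩
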